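/- For two linear subspaces $\mathcal X_1,\mathcal X_2$ of a Euclidean space let $D(\mathcal X_1,\mathcal X_2)=\frac{1}{\sqrt2}\,\|U_1U_1^{T}-U_2U_2^{T}\|_{F}$ denote their projection F-norm distance, where the columns of $U_i$ form an arbitrary orthonormal basis of $\mathcal X_i$ (the value does not depend on the choice) and $\|\cdot\|_F$ is the Frobenius norm. **Theorem.** For every $\varepsilon>0$ there exist constants $c_1(\varepsilon),c_2(\varepsilon)>0$, depending only on $\varepsilon$, such that the following holds. Let $n<N$, $d$ and $L$ be natural numbers with $n>c_1(\varepsilon)\max\{d,\ln L\}$, let $\mathcal X_1,\dots,\mathcal X_L\subset\mathbb R^N$ be linear subspaces of dimension less than $d$, let $\Phi\in\mathbb R^{n\times N}$ be a random matrix with independent $\mathcal N(0,1/n)$ entries, and let $\mathcal Y_i=\{\Phi x : x\in\mathcal X_i\}\subset\mathbb R^n$ for $i=1,\dots,L$. Then, with probability at least $1-e^{-c_2(\varepsilon)n}$, the inequalities $$(1-\varepsilon)\,D^2(\mathcal X_i,\mathcal X_j)<D^2(\mathcal Y_i,\mathcal Y_j)<(1+\varepsilon)\,D^2(\mathcal X_i,\mathcal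 X_j)$$ hold simultaneously for all $i,j$ with $\mathcal X_i\neq\mathcal X_j$. -/

import Mathlib

open MeasureTheory ProbabilityTheory
open scoped Matrix NNReal

noncomputable section

namespace SubspaceRIP

/-- The `N × r` matrix whose columns are the vectors of an orthonormal basis `b` of the
subspace `X` of `ℝ^N`. -/
def basisMatrix {N r : ℕ} {X : Submodule ℝ (EuclideanSpace ℝ (Fin N))}
    (b : OrthonormalBasis (Fin r) ℝ X) : Matrix (Fin N) (Fin r) ℝ :=
  Matrix.of fun i k => (b k : EuclideanSpace ℝ (Fin N)) i

/-- `U * Uᵀ` is the matrix of the orthogonal projection onto `X`, so it does not depend on the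
orthonormal basis. -/
theorem basisMatrix_mul_transpose_apply {N r : ℕ}
    {X : Submodule ℝ (EuclideanSpace ℝ (Fin N))}
    (b : OrthonormalBasis (Fin r) ℝ X) (i j : Fin N) :
    (basisMatrix b * (basisMatrix b)ᵀ) i j =
      X.starProjection (EuclideanSpace.single j (1 : ℝ)) i := by
  rw [b.starProjection_eq_sum_rankOne]
  simp [basisMatrix, Matrix.mul_apply, mul_comm, EuclideanSpace.inner_single_right]

section

attribute [local instance] Matrix.frobeniusNormedAddCommGroup

/-- The projection F-norm distance `D(X₁, X₂) = ‖U₁ U₁ᵀ - U₂ U₂ᵀ‖_F / √2` between two subspaces of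
`ℝ^N`, where `Uᵢ` is an orthonormal basis matrix of `Xᵢ` (see `projFDist_eq` for the independence
of the choice) and `‖·‖` is the Frobenius norm. -/
def projFDist {N : ℕ} (X₁ X₂ : Submodule ℝ (EuclideanSpace ℝ (Fin N))) : ℝ :=
  1 / √2 *
    ‖basisMatrix (stdOrthonormalBasis ℝ X₁) * (basisMatrix (stdOrthonormalBasis ℝ X₁))ᵀ -
      basisMatrix (stdOrthonormalBasis ℝ X₂) * (basisMatrix (stdOrthonormalBasis ℝ X₂))ᵀ‖

/-- The distance can be computed from arbitrary orthonormal bases of the two subspaces. -/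
theorem projFDist_eq {N r₁ r₂ : ℕ} {X₁ X₂ : Submodule ℝ (EuclideanSpace ℝ (Fin N))}
    (b₁ : OrthonormalBasis (Fin r₁) ℝ X₁) (b₂ : OrthonormalBasis (Fin r₂) ℝ X₂) :
    projFDist X₁ X₂ =
      1 / √2 * ‖basisMatrix b₁ * (basisMatrix b₁)ᵀ - basisMatrix b₂ * (basisMatrix b₂)ᵀ‖ := by
  have h₁ : basisMatrix (stdOrthonormalBasis ℝ X₁) * (basisMatrix (stdOrthonormalBasis ℝ X₁))ᵀ =
      basisMatrix b₁ * (basisMatrix b₁)ᵀ := by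
    ext i j
    simp only [basisMatrix_mul_transpose_apply]
  have h₂ : basisMatrix (stdOrthonormalBasis ℝ X₂) * (basisMatrix (stdOrthonormalBasis ℝ X₂))ᵀ =
      basisMatrix b₂ * (basisMatrix b₂)ᵀ := by
    ext i j
    simp only [basisMatrix_mul_transpose_apply]
  rw [projFDist, h₁, h₂]

/-- The distance written out in entries. -/
theorem projFDist_sq {N : ℕ} (X₁ X₂ : Submodule ℝ (EuclideanSpace ℝ (Fin N))) :
    projFDist X₁ X₂ ^ 2 = 1 / 2 * ∑ i, ∑ j,
      (X₁.starProjection (EuclideanSpace.single j (1 : ℝ)) i -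
        X₂.starProjection (EuclideanSpace.single j (1 : ℝ)) i) ^ 2 := by
  have h0 : 0 ≤ ∑ i, ∑ j,
      (X₁.starProjection (EuclideanSpace.single j (1 : ℝ)) i -
        X₂.starProjection (EuclideanSpace.single j (1 : ℝ)) i) ^ 2 := by positivity
  rw [projFDist, Matrix.frobenius_norm_def, ← Real.sqrt_eq_rpow, mul_pow]
  simp only [Matrix.sub_apply, basisMatrix_mul_transpose_apply, Real.norm_eq_abs,
    Real.rpow_two, sq_abs]
  rw [Real.sq_sqrt h0, div_pow, Real.sq_sqrt (by norm_num)]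
  norm_num

end

/-- The image `{A x | x ∈ X} ⊆ ℝ^n` of a subspace `X` of `ℝ^N` under an `n × N` matrix `A`. -/
def projectSubspace {n N : ℕ} (A : Matrix (Fin n) (Fin N) ℝ)
    (X : Submodule ℝ (EuclideanSpace ℝ (Fin N))) : Submodule ℝ (EuclideanSpace ℝ (Fin n)) :=
  X.map (Matrix.toEuclideanLin A)

/-- `Φ` is a random `n × N` matrix with independent entries, each with law `𝒩(0, 1/n)`
(`gaussianReal` takes the mean and the variance). -/
structure IsGaussianMatrix {Ω : Type*} [MeasurableSpace Ω] (P : Measure Ω) {n N : ℕ}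
    (Φ : Ω → Matrix (Fin n) (Fin N) ℝ) : Prop where
  hasLaw : ∀ i j, HasLaw (fun ω => Φ ω i j) (gaussianReal 0 (1 / (n : ℝ≥0))) P
  indep : iIndepFun (fun (p : Fin n × Fin N) ω => Φ ω p.1 p.2) P

end SubspaceRIP

end

/-! Let `P_X` be the orthogonal projection onto `X`. Expanding `‖P_X - P_Y‖_F²` as a trace shows
that `D²(X, Y)` is half the sum of the squared distances to `Y` of an orthonormal basis of `X`, plus
the same with `X` and `Y` exchanged.

Suppose `A` preserves squared norms on `X ⊔ Y` up to a factor `1 ± δ`, with `δ < 1`. Distances from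
points of `X` to `Y` are norms of vectors of `X ⊔ Y`, so they are nearly preserved
(`IsNearIsometryOn.orthogonal_bounds`). The images of an orthonormal basis of `X` are no longer
orthonormal, but they form a frame of `A X` with bounds `1 ± δ`, and sums of squared distances over
them may be replaced by sums over a true orthonormal basis (`IsNearIsometryOn.sum_image_bounds`).
Hence `D²` changes at most by the factor `(1 + δ) / (1 - δ)` either way.

A Gaussian matrix is such a near-isometry on all `X i ⊔ X j` at once: chi-square concentration
handles one vector, a net one subspace, and a union bound all pairs. The cost `L² · 2500^d` is
absorbed when `n` dominates `max d (log L)`. -/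

namespace SubspaceRIP

/-! ### Chi-square concentration for one vector -/

section Concentration

variable {Ω : Type*} [MeasurableSpace Ω] {P : Measure Ω}

theorem mgf_sq_gaussianReal {v : ℝ≥0} (hv : v ≠ 0) {t : ℝ} (ht : 2 * t * v < 1) :
    mgf (fun x => x ^ 2) (gaussianReal 0 v) t = (√(1 - 2 * t * v))⁻¹ := by
  have hv0 : (0 : ℝ) < v := by positivity
  have h1 : 0 < 1 - 2 * t * v := by linarith
  rw [mgf, integral_gaussianReal_eq_integral_smul hv]
  have h : ∀ x : ℝ, gaussianPDFReal 0 v x • Real.exp (t * x ^ 2) =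
      (√(2 * Real.pi * v))⁻¹ * Real.exp (-((1 - 2 * t * v) / (2 * v)) * x ^ 2) := by
    intro x
    rw [gaussianPDFReal, smul_eq_mul, mul_assoc, ← Real.exp_add]
    congr 2
    field_simp
    ring
  simp_rw [h]
  rw [integral_const_mul, integral_gaussian, ← Real.sqrt_inv, ← Real.sqrt_inv,
    ← Real.sqrt_mul (by positivity)]
  congr 1
  field_simp

/-- Second-order Taylor bound for the logarithm: `log (1 - 2u) ≥ -2u - 8u²`, then halve. -/
theorem inv_sqrt_one_sub_le_exp {u : ℝ} (hu : |u| ≤ 1 / 4) :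
    (√(1 - 2 * u))⁻¹ ≤ Real.exp (u + 4 * u ^ 2) := by
  have habs := abs_le.1 hu
  have h2 : |2 * u| ≤ 1 / 2 := by rw [abs_mul, abs_two]; linarith
  have hpos : 0 < 1 - 2 * u := by linarith
  have hlog := Real.abs_log_sub_add_sum_range_le (x := 2 * u) (by linarith) 1
  have hfrac : |2 * u| ^ 2 / (1 - |2 * u|) ≤ 2 * (2 * u) ^ 2 := by
    rw [div_le_iff₀ (by linarith), sq_abs]
    nlinarith [sq_nonneg (2 * u)]
  simp only [Finset.range_one, Finset.sum_singleton, zero_add, pow_one, Nat.cast_zero,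
    div_one, one_add_one_eq_two] at hlog
  have hlow := (abs_le.1 (hlog.trans hfrac)).1
  rw [← Real.log_le_iff_le_exp (by positivity), Real.log_inv, Real.log_sqrt hpos.le]
  linarith

/-- A linear combination of independent centred Gaussian variables is Gaussian. -/
theorem hasLaw_sum_mul_gaussianReal {κ : Type*} [Fintype κ] {Y : κ → Ω → ℝ} {v : ℝ≥0}
    (hY : ∀ j, HasLaw (Y j) (gaussianReal 0 v) P) (hi : iIndepFun Y P) (x : κ → ℝ) :
    HasLaw (fun ω => ∑ j, Y j ω * x j)
      (gaussianReal 0 (v * ∑ j, NNReal.mk (x j ^ 2) (sq_nonneg _))) P := by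
  have hP := hi.isProbabilityMeasure
  have hm : ∀ j, AEMeasurable (fun ω => Y j ω * x j) P := fun j =>
    (hY j).aemeasurable.mul_const _
  have hi' : iIndepFun (fun j ω => Y j ω * x j) P :=
    hi.comp (fun j y => y * x j) fun j => by fun_prop
  classical
  have key : ∀ s : Finset κ, P.map (∑ j ∈ s, fun ω => Y j ω * x j) =
      gaussianReal 0 (v * ∑ j ∈ s, NNReal.mk (x j ^ 2) (sq_nonneg _)) := by
    intro s
    induction s using Finset.induction_on with
    | empty =>
      simp only [Finset.sum_empty, mul_zero, gaussianReal_zero_var]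
      exact (Measure.map_const P (0 : ℝ)).trans (by simp)
    | insert j s hj ih =>
      rw [Finset.sum_insert hj, Finset.sum_insert hj, gaussianReal_add_gaussianReal_of_indepFun
        (hi'.indepFun_finsetSum_of_notMem₀ hm hj).symm
        (gaussianReal_mul_const (hY j) (x j)).map_eq ih]
      simp only [mul_zero, add_zero, mul_add]
      congr 2
      exact mul_comm _ _
  refine ⟨by fun_prop, ?_⟩
  rw [← key Finset.univ]
  congr 1
  ext ω
  simp

/-- The rows of a matrix with independent entries are independent. -/
theorem iIndepFun_curry {ι κ : Type*} [Countable ι] [Countable κ] {Y : ι → κ → Ω → ℝ}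
    (hm : ∀ i j, AEMeasurable (Y i j) P) (hi : iIndepFun (fun p : ι × κ => Y p.1 p.2) P) :
    iIndepFun (fun i ω j => Y i j ω) P := by
  have hP := hi.isProbabilityMeasure
  have hlaw : ∀ i j, IsProbabilityMeasure (P.map (Y i j)) := fun i j =>
    Measure.isProbabilityMeasure_map (hm i j)
  rw [iIndepFun_iff_map_fun_eq_infinitePi_map₀' fun i => aemeasurable_pi_iff.2 (hm i)]
  have hrow : ∀ i, iIndepFun (Y i) P := fun i =>
    hi.precomp (g := fun j => (i, j)) fun a b h => by simpa using h
  have h1 := hi.map_fun_eq_infinitePi_map₀' fun p : ι × κ => hm p.1 p.2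
  simp_rw [fun i => (hrow i).map_fun_eq_infinitePi_map₀' (hm i)]
  rw [← Measure.infinitePi_map_curry, ← h1, AEMeasurable.map_map_of_aemeasurable (by fun_prop)
    (aemeasurable_pi_iff.2 fun p : ι × κ => hm p.1 p.2)]
  rfl

theorem mgf_sum_sq_le {ι : Type*} [Fintype ι] {Y : ι → Ω → ℝ} {v : ℝ≥0} (hv : v ≠ 0)
    (hY : ∀ i, HasLaw (Y i) (gaussianReal 0 v) P) (hi : iIndepFun Y P) {t : ℝ}
    (ht : |t * v| ≤ 1 / 4) :
    Integrable (fun ω => Real.exp (t * ∑ i, Y i ω ^ 2)) P ∧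
      mgf (fun ω => ∑ i, Y i ω ^ 2) P t ≤
        Real.exp (Fintype.card ι * (t * v + 4 * (t * v) ^ 2)) := by
  have hP := hi.isProbabilityMeasure
  have habs := abs_le.1 ht
  have hm : ∀ i, AEMeasurable (fun ω => Y i ω ^ 2) P := fun i => (hY i).aemeasurable.pow_const 2
  have hi' : iIndepFun (fun i ω => Y i ω ^ 2) P := hi.comp (fun _ y => y ^ 2) fun _ => by fun_prop
  have h1 : ∀ i, mgf (fun ω => Y i ω ^ 2) P t = (√(1 - 2 * (t * v)))⁻¹ := by
    intro i
    have := (hY i).integral_comp (f := fun y => Real.exp (t * y ^ 2)) (by fun_prop)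
    rw [← mul_assoc, ← mgf_sq_gaussianReal hv (by linarith)]
    exact this
  have hsum : mgf (fun ω => ∑ i, Y i ω ^ 2) P t = ((√(1 - 2 * (t * v)))⁻¹) ^ Fintype.card ι := by
    have := hi'.mgf_sum₀ (t := t) hm Finset.univ
    simp only [h1, Finset.prod_const, Finset.card_univ] at this
    rw [← this]
    congr 1
    ext ω
    simp
  constructor
  -- A nonzero mgf already gives integrability, since the integral of a non-integrable function is
  -- `0` by convention.
  · have hpos : 0 < 1 - 2 * (t * v) := by linarith
    have : 0 < mgf (fun ω => ∑ i, Y i ω ^ 2) P t := by rw [hsum]; positivity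
    exact (mgf_pos_iff.1 this)
  · rw [hsum, Real.exp_nat_mul]
    gcongr
    exact inv_sqrt_one_sub_le_exp ht

/-- Concentration of the squared norm of a vector with independent `𝒩(0, v)` coordinates. -/
theorem measureReal_abs_sum_sq_sub_le {ι : Type*} [Fintype ι] {Y : ι → Ω → ℝ} {v : ℝ≥0}
    (hv : v ≠ 0) (hY : ∀ i, HasLaw (Y i) (gaussianReal 0 v) P) (hi : iIndepFun Y P) {δ : ℝ}
    (hδ0 : 0 ≤ δ) (hδ : δ ≤ 2) :
    P.real {ω | δ * (Fintype.card ι * v) < |∑ i, Y i ω ^ 2 - Fintype.card ι * v|} ≤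
      2 * Real.exp (-(Fintype.card ι * (δ ^ 2 / 16))) := by
  have hP := hi.isProbabilityMeasure
  have hv0 : (0 : ℝ) < v := by positivity
  -- With `s = t * v`, the Chernoff exponent per coordinate is `4 * s ^ 2 - s * δ`, minimal at `s =
  -- δ / 8`, with value `-δ ^ 2 / 16`. The bound `δ ≤ 2` keeps `s ≤ 1 / 4`.
  have htv : δ / (8 * v) * v = δ / 8 := by field_simp
  obtain ⟨i1, m1⟩ := mgf_sum_sq_le hv hY hi (t := δ / (8 * v))
    (by rw [htv, abs_of_nonneg (by linarith)]; linarith)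
  obtain ⟨i2, m2⟩ := mgf_sum_sq_le hv hY hi (t := -(δ / (8 * v)))
    (by rw [neg_mul, abs_neg, htv, abs_of_nonneg (by linarith)]; linarith)
  rw [htv] at m1
  rw [neg_mul, htv] at m2
  set m : ℝ := (Fintype.card ι : ℝ)
  have b1 := measure_ge_le_exp_mul_mgf ((1 + δ) * (m * v)) (by positivity) i1
  have b2 := measure_le_le_exp_mul_mgf ((1 - δ) * (m * v))
    (neg_nonpos.2 (by positivity : 0 ≤ δ / (8 * (v : ℝ)))) i2
  have c1 : P.real {ω | (1 + δ) * (m * v) ≤ ∑ i, Y i ω ^ 2} ≤ Real.exp (-(m * (δ ^ 2 / 16))) := by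
    refine b1.trans ((mul_le_mul_of_nonneg_left m1 (Real.exp_pos _).le).trans (le_of_eq ?_))
    rw [← Real.exp_add]
    congr 1
    field_simp
    ring
  have c2 : P.real {ω | ∑ i, Y i ω ^ 2 ≤ (1 - δ) * (m * v)} ≤ Real.exp (-(m * (δ ^ 2 / 16))) := by
    refine b2.trans ((mul_le_mul_of_nonneg_left m2 (Real.exp_pos _).le).trans (le_of_eq ?_))
    rw [← Real.exp_add]
    congr 1
    field_simp
    ring
  have hsub : {ω | δ * (m * v) < |∑ i, Y i ω ^ 2 - m * v|} ⊆
      {ω | (1 + δ) * (m * v) ≤ ∑ i, Y i ω ^ 2} ∪ {ω | ∑ i, Y i ω ^ 2 ≤ (1 - δ) * (m * v)} := by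
    intro ω hω
    rcases lt_abs.1 (Set.mem_ofPred_eq ▸ hω) with h | h
    · left
      simp only [Set.mem_ofPred_eq]
      linarith
    · right
      simp only [Set.mem_ofPred_eq]
      linarith
  calc _ ≤ _ := measureReal_mono hsub
    _ ≤ _ := measureReal_union_le _ _
    _ ≤ _ := by linarith

theorem IsGaussianMatrix.measureReal_norm_sq_sub_le [IsProbabilityMeasure P] {n N : ℕ}
    {Φ : Ω → Matrix (Fin n) (Fin N) ℝ} (hΦ : IsGaussianMatrix P Φ) {δ : ℝ} (hδ0 : 0 ≤ δ)
    (hδ : δ ≤ 2) (hn : 0 < n) (x : EuclideanSpace ℝ (Fin N)) :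
    P.real {ω | δ * ‖x‖ ^ 2 < |‖Matrix.toEuclideanLin (Φ ω) x‖ ^ 2 - ‖x‖ ^ 2|} ≤
      2 * Real.exp (-(n * (δ ^ 2 / 16))) := by
  rcases eq_or_ne x 0 with rfl | hx
  · simp only [map_zero, norm_zero]
    norm_num
    positivity
  have hrow : ∀ i, HasLaw (fun ω => ∑ j, Φ ω i j * x j)
      (gaussianReal 0 (1 / n * ∑ j, NNReal.mk (x j ^ 2) (sq_nonneg _))) P := fun i =>
    hasLaw_sum_mul_gaussianReal (hΦ.hasLaw i)
      (hΦ.indep.precomp (g := fun j => (i, j)) fun a b h => by simpa using h) x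
  have hind : iIndepFun (fun i ω => ∑ j, Φ ω i j * x j) P :=
    (iIndepFun_curry (fun i j => (hΦ.hasLaw i j).aemeasurable) hΦ.indep).comp
      (fun _ y => ∑ j, y j * x j) fun _ => by fun_prop
  have hnorm : ‖x‖ ^ 2 = ∑ j, x j ^ 2 := by simp [EuclideanSpace.norm_sq_eq]
  have hv : ((1 / n * ∑ j, NNReal.mk (x j ^ 2) (sq_nonneg _) : ℝ≥0) : ℝ) = ‖x‖ ^ 2 / n := by
    rw [hnorm]
    push_cast
    simp
    ring
  have hn' : (0 : ℝ) < n := by exact_mod_cast hn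
  have := measureReal_abs_sum_sq_sub_le (fun h0 => ?_) hrow hind hδ0 hδ
  · rw [hv, Fintype.card_fin, mul_div_cancel₀ _ hn'.ne'] at this
    convert this using 6 with ω
    simp [EuclideanSpace.norm_sq_eq, Matrix.mulVec, dotProduct]
  · rw [h0, NNReal.coe_zero] at hv
    have : 0 < ‖x‖ ^ 2 / n := by positivity
    linarith

end Concentration

/-! ### Near-isometries and the projection distance -/

section Deterministic

open scoped RealInnerProductSpace

variable {E F ι κ : Type*} [NormedAddCommGroup E] [InnerProductSpace ℝ E]
  [NormedAddCommGroup F] [InnerProductSpace ℝ F] [Fintype ι] [Fintype κ]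

/-- `A` is a `δ`-near-isometry on the subspace `X`. -/
def IsNearIsometryOn (A : E →ₗ[ℝ] F) (δ : ℝ) (X : Submodule ℝ E) : Prop :=
  ∀ x ∈ X, |‖A x‖ ^ 2 - ‖x‖ ^ 2| ≤ δ * ‖x‖ ^ 2

variable {A : E →ₗ[ℝ] F} {δ : ℝ} {X Y : Submodule ℝ E}

theorem IsNearIsometryOn.mono (h : IsNearIsometryOn A δ Y) (hXY : X ≤ Y) :
    IsNearIsometryOn A δ X := fun x hx => h x (hXY hx)

theorem IsNearIsometryOn.lower (h : IsNearIsometryOn A δ X) {x : E} (hx : x ∈ X) :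
    (1 - δ) * ‖x‖ ^ 2 ≤ ‖A x‖ ^ 2 := by
  have := (abs_le.1 (h x hx)).1
  linarith

theorem IsNearIsometryOn.upper (h : IsNearIsometryOn A δ X) {x : E} (hx : x ∈ X) :
    ‖A x‖ ^ 2 ≤ (1 + δ) * ‖x‖ ^ 2 := by
  have := (abs_le.1 (h x hx)).2
  linarith

variable [FiniteDimensional ℝ E]

/-- Both sides are the trace of `P_X T`, one computed in a basis of the whole space and the other in
a basis of `X`. -/
theorem sum_inner_starProjection_eq {X : Submodule ℝ E} (b : OrthonormalBasis κ ℝ X)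
    (e : OrthonormalBasis ι ℝ E) {T : E →ₗ[ℝ] E} (hT : T.IsSymmetric) :
    ∑ j, ⟪X.starProjection (e j), T (e j)⟫ = ∑ k, ⟪(b k : E), T (b k)⟫ := by
  have h : ∀ j, ⟪X.starProjection (e j), T (e j)⟫ =
      ∑ k, ⟪(b k : E), e j⟫ * ⟪e j, T (b k)⟫ := by
    intro j
    rw [b.starProjection_eq_sum_rankOne]
    simp only [sum_apply, InnerProductSpace.rankOne_apply, sum_inner,
      real_inner_smul_left]
    refine Finset.sum_congr rfl fun k _ => ?_
    rw [← hT (b k) (e j), real_inner_comm (T (b k))]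
  simp_rw [h]
  rw [Finset.sum_comm]
  exact Finset.sum_congr rfl fun k _ => e.sum_inner_mul_inner _ _

theorem inner_starProjection_self (Y : Submodule ℝ E) (x : E) :
    ⟪Y.starProjection x, x⟫ = ‖Y.starProjection x‖ ^ 2 := by
  have h := Y.re_inner_starProjection_eq_normSq x
  rwa [RCLike.re_to_real, Submodule.coe_norm, ← Submodule.starProjection_apply] at h

theorem norm_sq_orthogonal_starProjection (Y : Submodule ℝ E) (x : E) :
    ‖Yᗮ.starProjection x‖ ^ 2 = ‖x‖ ^ 2 - ⟪x, Y.starProjection x⟫ := by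
  have h1 := Y.norm_sq_eq_add_norm_sq_starProjection x
  have h2 := inner_starProjection_self Y x
  rw [real_inner_comm] at h2
  linarith

/-- The squared distance is the average of the two sums of squared distances of the vectors of an
orthonormal basis of one subspace to the other subspace. -/
theorem projFDist_sq_eq_sum {N : ℕ} {X Y : Submodule ℝ (EuclideanSpace ℝ (Fin N))}
    (b : OrthonormalBasis ι ℝ X) (c : OrthonormalBasis κ ℝ Y) :
    projFDist X Y ^ 2 = 1 / 2 * (∑ k, ‖Yᗮ.starProjection (b k : EuclideanSpace ℝ (Fin N))‖ ^ 2 +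
      ∑ k, ‖Xᗮ.starProjection (c k : EuclideanSpace ℝ (Fin N))‖ ^ 2) := by
  let e := EuclideanSpace.basisFun (Fin N) ℝ
  -- Column by column, `‖P_X - P_Y‖_F² = tr P_X + tr P_Y - tr P_X P_Y - tr P_Y P_X`; the two equal
  -- cross terms stay separate so that each pairs with one basis.
  have hsq : ∑ i, ∑ j, (X.starProjection (EuclideanSpace.single j (1 : ℝ)) i -
      Y.starProjection (EuclideanSpace.single j (1 : ℝ)) i) ^ 2 =
      ∑ j, (⟪X.starProjection (e j), e j⟫ + ⟪Y.starProjection (e j), e j⟫ -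
        ⟪X.starProjection (e j), Y.starProjection (e j)⟫ -
        ⟪Y.starProjection (e j), X.starProjection (e j)⟫) := by
    rw [Finset.sum_comm]
    refine Finset.sum_congr rfl fun j _ => ?_
    rw [inner_starProjection_self, inner_starProjection_self, real_inner_comm (X.starProjection (e j))]
    have h3 := norm_sub_sq_real (X.starProjection (e j)) (Y.starProjection (e j))
    rw [EuclideanSpace.norm_sq_eq] at h3
    simp only [PiLp.sub_apply, Real.norm_eq_abs, sq_abs, e, EuclideanSpace.basisFun_apply] at h3 ⊢
    rw [h3]
    ring
  have hid : (LinearMap.id : EuclideanSpace ℝ (Fin N) →ₗ[ℝ] _).IsSymmetric := fun _ _ => rfl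
  rw [projFDist_sq, hsq]
  simp only [Finset.sum_sub_distrib, Finset.sum_add_distrib]
  have t1 := sum_inner_starProjection_eq b e hid
  have t2 := sum_inner_starProjection_eq c e hid
  have t3 := sum_inner_starProjection_eq b e Y.starProjection_isSymmetric
  have t4 := sum_inner_starProjection_eq c e X.starProjection_isSymmetric
  simp only [LinearMap.id_apply, ContinuousLinearMap.coe_coe, real_inner_self_eq_norm_sq]
    at t1 t2 t3 t4
  simp only [norm_sq_orthogonal_starProjection, Finset.sum_sub_distrib]
  rw [t1, t2, t3, t4]
  ring

/-- Frame bounds for the image of an orthonormal basis under a near-isometry. -/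
theorem IsNearIsometryOn.frame_bounds (h : IsNearIsometryOn A δ X) (hδ : δ < 1) (hδ0 : 0 ≤ δ)
    (b : OrthonormalBasis κ ℝ X) (w : F) :
    (1 - δ) * ‖(X.map A).starProjection w‖ ^ 2 ≤ ∑ k, ⟪w, A (b k)⟫ ^ 2 ∧
      ∑ k, ⟪w, A (b k)⟫ ^ 2 ≤ (1 + δ) * ‖(X.map A).starProjection w‖ ^ 2 := by
  set p := (X.map A).starProjection w with hp
  have hwp : ∀ x ∈ X, ⟪w, A x⟫ = ⟪p, A x⟫ := by
    intro x hx
    have := (X.map A).starProjection_inner_eq_zero w (A x) (Submodule.mem_map_of_mem hx)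
    rw [inner_sub_left] at this
    linarith
  have hsum : ∑ k, ⟪w, A (b k)⟫ ^ 2 = ∑ k, ⟪p, A (b k)⟫ ^ 2 :=
    Finset.sum_congr rfl fun k _ => by rw [hwp _ (b k).2]
  rw [hsum]
  set S := ∑ k, ⟪p, A (b k)⟫ ^ 2 with hS
  have hS0 : 0 ≤ S := Finset.sum_nonneg fun _ _ => sq_nonneg _
  constructor
  -- Write `p = A x` and expand `x` in `b`: Cauchy–Schwarz gives `‖p‖⁴ ≤ ‖x‖² S`, and `‖x‖²` is
  -- controlled by `‖p‖²`.
  · obtain ⟨x, hx, hxp⟩ := (X.map A).starProjection_apply_mem w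
    rw [← hp] at hxp
    have hlow := h.lower hx
    rw [hxp] at hlow
    have hrep : ‖p‖ ^ 2 = ∑ k, ⟪b k, (⟨x, hx⟩ : X)⟫ * ⟪p, A (b k)⟫ := by
      have h1 : x = ∑ k, ⟪b k, (⟨x, hx⟩ : X)⟫ • (b k : E) := by
        have := congrArg (Subtype.val) (b.sum_repr' ⟨x, hx⟩)
        simpa using this.symm
      have h2 : p = ∑ k, ⟪b k, (⟨x, hx⟩ : X)⟫ • A (b k) := by
        rw [← hxp]
        conv_lhs => rw [h1]
        simp
      rw [← real_inner_self_eq_norm_sq]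
      nth_rw 2 [h2]
      rw [inner_sum]
      simp [real_inner_smul_right]
    have hcs := Finset.sum_mul_sq_le_sq_mul_sq Finset.univ
      (fun k => ⟪b k, (⟨x, hx⟩ : X)⟫) fun k => ⟪p, A (b k)⟫
    rw [← hrep, b.sum_sq_inner_right, ← hS, Submodule.coe_norm] at hcs
    simp only at hcs
    rcases eq_or_lt_of_le (sq_nonneg ‖p‖) with h0 | h0
    · rw [← h0]; simpa using hS0
    · have : ‖p‖ ^ 2 * ((1 - δ) * ‖p‖ ^ 2) ≤ ‖p‖ ^ 2 * S := by
        calc _ = (1 - δ) * (‖p‖ ^ 2) ^ 2 := by ring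
          _ ≤ (1 - δ) * (‖x‖ ^ 2 * S) := mul_le_mul_of_nonneg_left hcs (by linarith)
          _ = (1 - δ) * ‖x‖ ^ 2 * S := by ring
          _ ≤ _ := mul_le_mul_of_nonneg_right hlow hS0
      exact le_of_mul_le_mul_left this h0
  -- Here `s` is the adjoint of `A` restricted to `X`, applied to `p`, so `‖s‖² = S = ⟪p, A s⟫`.
  · set s : X := ∑ k, ⟪p, A (b k)⟫ • b k with hs
    have hns : ‖s‖ ^ 2 = S := by
      rw [← b.sum_sq_inner_right s]
      refine Finset.sum_congr rfl fun k _ => ?_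
      rw [hs, b.orthonormal.inner_right_fintype]
    have hSs : S = ⟪p, A s⟫ := by
      rw [hs]
      simp [inner_sum, real_inner_smul_right, S, sq]
    have hup := h.upper s.2
    rw [← Submodule.coe_norm, hns] at hup
    have hcs : S ^ 2 ≤ ‖p‖ ^ 2 * ‖A s‖ ^ 2 := by
      rw [hSs, ← mul_pow, ← sq_abs]
      exact pow_le_pow_left₀ (abs_nonneg _) (abs_real_inner_le_norm _ _) 2
    rcases eq_or_lt_of_le hS0 with h0 | h0
    · rw [← h0]; positivity
    · have : S * S ≤ S * ((1 + δ) * ‖p‖ ^ 2) := by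
        calc _ = S ^ 2 := by ring
          _ ≤ _ := hcs
          _ ≤ ‖p‖ ^ 2 * ((1 + δ) * S) := mul_le_mul_of_nonneg_left hup (sq_nonneg _)
          _ = _ := by ring
      exact le_of_mul_le_mul_left this h0

variable [FiniteDimensional ℝ F]

theorem sum_norm_sq_starProjection_eq (Z : Submodule ℝ F) (u : κ → F)
    (f : OrthonormalBasis ι ℝ F) :
    ∑ k, ‖Z.starProjection (u k)‖ ^ 2 = ∑ i, ∑ k, ⟪Z.starProjection (f i), u k⟫ ^ 2 := by
  simp_rw [← f.sum_sq_inner_right]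
  rw [Finset.sum_comm]
  simp_rw [Z.inner_starProjection_left_eq_right]

/-- After exchanging sums, each side is a sum over a basis `f` of `F` of frame sums at `w =
Z.starProjection (f i)`. For `b'` the frame sum is exactly `‖(X.map A).starProjection w‖ ^ 2`, so no
matching of individual vectors is needed. -/
theorem IsNearIsometryOn.sum_image_bounds (h : IsNearIsometryOn A δ X) (hδ : δ < 1) (hδ0 : 0 ≤ δ)
    (b : OrthonormalBasis κ ℝ X) (b' : OrthonormalBasis ι ℝ (X.map A)) (Z : Submodule ℝ F) :
    (1 - δ) * ∑ k, ‖Z.starProjection (b' k : F)‖ ^ 2 ≤ ∑ k, ‖Z.starProjection (A (b k))‖ ^ 2 ∧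
      ∑ k, ‖Z.starProjection (A (b k))‖ ^ 2 ≤ (1 + δ) * ∑ k, ‖Z.starProjection (b' k : F)‖ ^ 2 := by
  let f := stdOrthonormalBasis ℝ F
  have h' : ∀ w : F, ∑ k, ⟪w, (b' k : F)⟫ ^ 2 = ‖(X.map A).starProjection w‖ ^ 2 := by
    intro w
    rw [Submodule.starProjection_apply, ← Submodule.coe_norm, ← b'.sum_sq_inner_left]
    simp
  rw [sum_norm_sq_starProjection_eq Z (fun k => (b' k : F)) f,
    sum_norm_sq_starProjection_eq Z (fun k => A (b k)) f, Finset.mul_sum, Finset.mul_sum]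
  simp only [h']
  exact ⟨Finset.sum_le_sum fun i _ => (h.frame_bounds hδ hδ0 b _).1,
    Finset.sum_le_sum fun i _ => (h.frame_bounds hδ hδ0 b _).2⟩

theorem norm_orthogonal_starProjection_le (Y : Submodule ℝ F) (u : F) {y : F} (hy : y ∈ Y) :
    ‖Yᗮ.starProjection u‖ ≤ ‖u - y‖ := by
  have : Yᗮ.starProjection u = Yᗮ.starProjection (u - y) := by
    rw [map_sub, (Submodule.starProjection_apply_eq_zero_iff Yᗮ).2
      (Y.le_orthogonal_orthogonal hy), sub_zero]
  rw [this]
  exact Submodule.norm_starProjection_apply_le _ _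

/-- Both norms are minimal distances; in each direction the minimiser for one problem is used as a
competitor in the other. -/
theorem IsNearIsometryOn.orthogonal_bounds (h : IsNearIsometryOn A δ (X ⊔ Y)) (hδ : δ < 1)
    {u : E} (hu : u ∈ X) :
    (1 - δ) * ‖Yᗮ.starProjection u‖ ^ 2 ≤ ‖(Y.map A)ᗮ.starProjection (A u)‖ ^ 2 ∧
      ‖(Y.map A)ᗮ.starProjection (A u)‖ ^ 2 ≤ (1 + δ) * ‖Yᗮ.starProjection u‖ ^ 2 := by
  have hmem : ∀ y ∈ Y, u - y ∈ X ⊔ Y := fun y hy =>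
    Submodule.sub_mem _ (Submodule.mem_sup_left hu) (Submodule.mem_sup_right hy)
  constructor
  · obtain ⟨z, hz, hzA⟩ := (Y.map A).starProjection_apply_mem (A u)
    rw [Submodule.starProjection_orthogonal_val (K := Y.map A), ← hzA, ← map_sub]
    refine le_trans ?_ (h.lower (hmem z hz))
    have hle : ‖Yᗮ.starProjection u‖ ≤ ‖u - z‖ := norm_orthogonal_starProjection_le Y u hz
    exact mul_le_mul_of_nonneg_left (pow_le_pow_left₀ (norm_nonneg _) hle 2) (by linarith)
  · have hy := Y.starProjection_apply_mem u
    rw [Submodule.starProjection_orthogonal_val (K := Y)]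
    refine le_trans ?_ (h.upper (hmem _ hy))
    rw [map_sub]
    gcongr
    exact norm_orthogonal_starProjection_le _ _ (Submodule.mem_map_of_mem hy)

/-- A near-isometry on `X ⊔ Y` nearly preserves the one-sided sum of squared distances. -/
theorem IsNearIsometryOn.sum_orthogonal_bounds (h : IsNearIsometryOn A δ (X ⊔ Y)) (hδ : δ < 1)
    (hδ0 : 0 ≤ δ) (b : OrthonormalBasis κ ℝ X) (b' : OrthonormalBasis ι ℝ (X.map A)) :
    (1 - δ) * ∑ k, ‖Yᗮ.starProjection (b k : E)‖ ^ 2 ≤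
        (1 + δ) * ∑ k, ‖(Y.map A)ᗮ.starProjection (b' k : F)‖ ^ 2 ∧
      (1 - δ) * ∑ k, ‖(Y.map A)ᗮ.starProjection (b' k : F)‖ ^ 2 ≤
        (1 + δ) * ∑ k, ‖Yᗮ.starProjection (b k : E)‖ ^ 2 := by
  obtain ⟨h1, h2⟩ := (h.mono le_sup_left).sum_image_bounds hδ hδ0 b b' (Y.map A)ᗮ
  have h3 := fun k => h.orthogonal_bounds hδ (b k).2
  refine ⟨le_trans ?_ h2, h1.trans ?_⟩
  · rw [Finset.mul_sum]
    exact Finset.sum_le_sum fun k _ => (h3 k).1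
  · rw [Finset.mul_sum]
    exact Finset.sum_le_sum fun k _ => (h3 k).2

theorem projFDist_bounds_of_isNearIsometryOn {n N : ℕ} {M : Matrix (Fin n) (Fin N) ℝ}
    {X Y : Submodule ℝ (EuclideanSpace ℝ (Fin N))}
    (h : IsNearIsometryOn (Matrix.toEuclideanLin M) δ (X ⊔ Y)) (hδ : δ < 1) (hδ0 : 0 ≤ δ) :
    (1 - δ) * projFDist X Y ^ 2 ≤
        (1 + δ) * projFDist (projectSubspace M X) (projectSubspace M Y) ^ 2 ∧
      (1 - δ) * projFDist (projectSubspace M X) (projectSubspace M Y) ^ 2 ≤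
        (1 + δ) * projFDist X Y ^ 2 := by
  rw [projFDist_sq_eq_sum (stdOrthonormalBasis ℝ X) (stdOrthonormalBasis ℝ Y),
    projFDist_sq_eq_sum (stdOrthonormalBasis ℝ (projectSubspace M X))
      (stdOrthonormalBasis ℝ (projectSubspace M Y))]
  have h1 := h.sum_orthogonal_bounds hδ hδ0 (stdOrthonormalBasis ℝ X)
    (stdOrthonormalBasis ℝ (projectSubspace M X))
  rw [sup_comm] at h
  have h2 := h.sum_orthogonal_bounds hδ hδ0 (stdOrthonormalBasis ℝ Y)
    (stdOrthonormalBasis ℝ (projectSubspace M Y))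
  have key : ∀ a b c d : ℝ, (1 - δ) * a ≤ (1 + δ) * c → (1 - δ) * b ≤ (1 + δ) * d →
      (1 - δ) * (1 / 2 * (a + b)) ≤ (1 + δ) * (1 / 2 * (c + d)) := by
    intro a b c d h₁ h₂
    linarith
  exact ⟨key _ _ _ _ h1.1 h2.1, key _ _ _ _ h1.2 h2.2⟩

theorem projFDist_sq_pos {N : ℕ} {X Y : Submodule ℝ (EuclideanSpace ℝ (Fin N))} (hXY : X ≠ Y) :
    0 < projFDist X Y ^ 2 := by
  refine lt_of_le_of_ne (sq_nonneg _) fun h0 => hXY ?_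
  rw [projFDist_sq, eq_comm, mul_eq_zero, or_iff_right (by norm_num),
    Finset.sum_eq_zero_iff_of_nonneg fun _ _ => Finset.sum_nonneg fun _ _ => sq_nonneg _] at h0
  have hP : X.starProjection = Y.starProjection := by
    apply ContinuousLinearMap.coe_injective
    refine (EuclideanSpace.basisFun (Fin N) ℝ).toBasis.ext fun j => ?_
    ext i
    have := (Finset.sum_eq_zero_iff_of_nonneg fun _ _ => sq_nonneg _).1
      (h0 i (Finset.mem_univ _)) j (Finset.mem_univ _)
    simpa [sub_eq_zero] using this
  rw [← X.range_starProjection, ← Y.range_starProjection, hP]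

end Deterministic

/-! ### Nets and reduction to finitely many vectors -/

section Net

variable {V G : Type*} [NormedAddCommGroup V] [NormedSpace ℝ V] [NormedAddCommGroup G]
  [NormedSpace ℝ G]

/-- The ball of radius `2` has a `1`-net with at most `5 ^ dim` points. -/
theorem exists_finset_net (V : Type*) [NormedAddCommGroup V] [NormedSpace ℝ V]
    [FiniteDimensional ℝ V] :
    ∃ s : Finset V, s.card ≤ 5 ^ Module.finrank ℝ V ∧ (∀ c ∈ s, ‖c‖ ≤ 2) ∧
      ∀ x : V, ‖x‖ ≤ 2 → ∃ c ∈ s, ‖x - c‖ ≤ 1 := by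
  classical
  let Sep : Finset V → Prop := fun s =>
    (∀ c ∈ s, ‖c‖ ≤ 2) ∧ ∀ c ∈ s, ∀ d ∈ s, c ≠ d → 1 ≤ ‖c - d‖
  let Q : ℕ → Prop := fun k => ∃ s : Finset V, Sep s ∧ s.card = k
  have hcard : ∀ s, Sep s → s.card ≤ 5 ^ Module.finrank ℝ V := fun s hs =>
    Besicovitch.card_le_of_separated s hs.1 hs.2
  have hQ0 : Q 0 := ⟨∅, by simp [Sep], rfl⟩
  -- A separated set of maximal cardinality is a net: a point far from all of it could be added.
  obtain ⟨s, hs, hsc⟩ := Nat.findGreatest_spec (P := Q) (Nat.zero_le (5 ^ Module.finrank ℝ V)) hQ0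
  refine ⟨s, hcard s hs, hs.1, fun x hx => ?_⟩
  by_contra! hfar
  have hxs : x ∉ s := fun h => by
    have := hfar x h
    simp only [sub_self, norm_zero] at this
    linarith
  have hins : Sep (insert x s) := by
    refine ⟨fun c hc => ?_, fun c hc d hd hcd => ?_⟩
    · rcases Finset.mem_insert.1 hc with rfl | h
      exacts [hx, hs.1 c h]
    · rcases Finset.mem_insert.1 hc with rfl | h <;> rcases Finset.mem_insert.1 hd with rfl | h'
      · exact absurd rfl hcd
      · exact (hfar d h').le
      · rw [norm_sub_rev]
        exact (hfar c h).le
      · exact hs.2 c h d h' hcd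
  have := Nat.le_findGreatest (P := Q) (hcard _ hins) ⟨_, hins, rfl⟩
  rw [← hsc, Finset.card_insert_of_notMem hxs] at this
  omega

/-- Testing on vectors of norm `2` gives `2‖f‖ ≤ m + ‖f‖`, so a `1`-net of this ball loses no
constant. -/
theorem opNorm_le_of_net {s : Finset V} (hs : ∀ x : V, ‖x‖ ≤ 2 → ∃ c ∈ s, ‖x - c‖ ≤ 1)
    (f : V →L[ℝ] G) {m : ℝ} (hm : 0 ≤ m) (hf : ∀ c ∈ s, ‖f c‖ ≤ m) : ‖f‖ ≤ m := by
  have h : ‖f‖ ≤ (m + ‖f‖) / 2 := by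
    refine f.opNorm_le_bound (by positivity) fun x => ?_
    rcases eq_or_ne x 0 with rfl | hx
    · simp
    have hx0 : 0 < ‖x‖ := norm_pos_iff.2 hx
    obtain ⟨c, hc, hxc⟩ := hs ((2 / ‖x‖) • x) (by
      rw [norm_smul, Real.norm_of_nonneg (by positivity), div_mul_cancel₀ _ hx0.ne'])
    have h1 : ‖f ((2 / ‖x‖) • x)‖ ≤ m + ‖f‖ := by
      have h2 : f ((2 / ‖x‖) • x) = f c + f ((2 / ‖x‖) • x - c) := by rw [map_sub]; abel
      rw [h2]
      exact (norm_add_le _ _).trans (add_le_add (hf c hc) (f.le_of_opNorm_le_of_le le_rfl hxc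
        |>.trans (by rw [mul_one])))
    rw [map_smul, norm_smul, Real.norm_of_nonneg (by positivity)] at h1
    rw [div_mul_eq_mul_div, div_le_iff₀ hx0] at h1
    linarith
  linarith

open scoped RealInnerProductSpace in
/-- To be a near-isometry it suffices to be one on the sums and differences of the points of a
net. -/
theorem abs_norm_sq_sub_le_of_net {E F : Type*} [NormedAddCommGroup E] [InnerProductSpace ℝ E]
    [NormedAddCommGroup F] [InnerProductSpace ℝ F] (A : E →L[ℝ] F)
    {δ : ℝ} (hδ : 0 ≤ δ) {s : Finset E} (hs2 : ∀ c ∈ s, ‖c‖ ≤ 2)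
    (hs : ∀ x : E, ‖x‖ ≤ 2 → ∃ c ∈ s, ‖x - c‖ ≤ 1)
    (hadd : ∀ a ∈ s, ∀ b ∈ s, |‖A (a + b)‖ ^ 2 - ‖a + b‖ ^ 2| ≤ δ / 4 * ‖a + b‖ ^ 2)
    (hsub : ∀ a ∈ s, ∀ b ∈ s, |‖A (a - b)‖ ^ 2 - ‖a - b‖ ^ 2| ≤ δ / 4 * ‖a - b‖ ^ 2) (x : E) :
    |‖A x‖ ^ 2 - ‖x‖ ^ 2| ≤ δ * ‖x‖ ^ 2 := by
  -- `B` is the polarisation of the defect `‖A x‖² - ‖x‖²`. On net points `4 B a b` is the defect at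
  -- `a + b` minus that at `a - b`, at most `δ / 4 * (2‖a‖² + 2‖b‖²) ≤ 4δ`. The net bound is then
  -- used once in each argument.
  let B : E →L[ℝ] E →L[ℝ] ℝ := (innerSL ℝ).bilinearComp A A - innerSL ℝ
  have hB : ∀ a b : E, B a b = ⟪A a, A b⟫ - ⟪a, b⟫ := fun a b => rfl
  have hnet : ∀ a ∈ s, ∀ b ∈ s, ‖B a b‖ ≤ δ := by
    intro a ha b hb
    have h1 := abs_le.1 (hadd a ha b hb)
    have h2 := abs_le.1 (hsub a ha b hb)
    have p1 := norm_add_sq_real a b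
    have p2 := norm_sub_sq_real a b
    have p3 := norm_add_sq_real (A a) (A b)
    have p4 := norm_sub_sq_real (A a) (A b)
    simp only [map_add, map_sub] at h1 h2
    have ha2 : ‖a‖ ^ 2 ≤ 4 := by nlinarith [hs2 a ha, norm_nonneg a]
    have hb2 : ‖b‖ ^ 2 ≤ 4 := by nlinarith [hs2 b hb, norm_nonneg b]
    have hsum : δ / 4 * ‖a + b‖ ^ 2 + δ / 4 * ‖a - b‖ ^ 2 ≤ 4 * δ := by
      rw [p1, p2]
      nlinarith [mul_le_mul_of_nonneg_left ha2 hδ, mul_le_mul_of_nonneg_left hb2 hδ]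
    rw [hB, Real.norm_eq_abs, abs_le]
    constructor <;> linarith [h1.1, h1.2, h2.1, h2.2]
  have hBn : ‖B‖ ≤ δ := opNorm_le_of_net hs B hδ fun a ha =>
    opNorm_le_of_net hs (B a) hδ (hnet a ha)
  have := B.le_of_opNorm₂_le_of_le hBn (le_refl ‖x‖) (le_refl ‖x‖)
  rw [hB, real_inner_self_eq_norm_sq, real_inner_self_eq_norm_sq, Real.norm_eq_abs] at this
  linarith

end Net

/-! ### Union bounds for Gaussian matrices and conclusion -/

variable {Ω : Type*} [MeasurableSpace Ω] {P : Measure Ω}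

/-- A Gaussian matrix is a near-isometry on a fixed subspace with high probability. -/
theorem IsGaussianMatrix.measureReal_not_isNearIsometryOn_le [IsProbabilityMeasure P] {n N : ℕ}
    {Φ : Ω → Matrix (Fin n) (Fin N) ℝ} (hΦ : IsGaussianMatrix P Φ) {δ : ℝ} (hδ0 : 0 ≤ δ)
    (hδ : δ ≤ 2) (hn : 0 < n) (X : Submodule ℝ (EuclideanSpace ℝ (Fin N))) :
    P.real {ω | ¬ IsNearIsometryOn (Matrix.toEuclideanLin (Φ ω)) δ X} ≤
      25 ^ Module.finrank ℝ X * (4 * Real.exp (-(n * (δ ^ 2 / 256)))) := by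
  obtain ⟨s, hcard, hs2, hs⟩ := exists_finset_net X
  let bad : EuclideanSpace ℝ (Fin N) → Set Ω := fun x =>
    {ω | δ / 4 * ‖x‖ ^ 2 < |‖Matrix.toEuclideanLin (Φ ω) x‖ ^ 2 - ‖x‖ ^ 2|}
  have hbad : ∀ x, P.real (bad x) ≤ 2 * Real.exp (-(n * (δ ^ 2 / 256))) := by
    intro x
    have := hΦ.measureReal_norm_sq_sub_le (δ := δ / 4) (by linarith) (by linarith) hn x
    rwa [show (δ / 4) ^ 2 / 16 = δ ^ 2 / 256 by ring] at this
  have hsub : {ω | ¬ IsNearIsometryOn (Matrix.toEuclideanLin (Φ ω)) δ X} ⊆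
      ⋃ p ∈ s ×ˢ s, (bad (p.1 + p.2 : X) ∪ bad (p.1 - p.2 : X)) := by
    intro ω hω
    by_contra hcon
    simp only [Set.mem_iUnion, not_exists, Set.mem_union, not_or, Finset.mem_product, bad,
      Set.mem_ofPred_eq, not_lt, Prod.forall] at hcon
    exact hω fun x hx => abs_norm_sq_sub_le_of_net
      (LinearMap.toContinuousLinearMap ((Matrix.toEuclideanLin (Φ ω)).domRestrict X)) hδ0 hs2 hs
      (fun a ha b hb => (hcon a b ⟨ha, hb⟩).1) (fun a ha b hb => (hcon a b ⟨ha, hb⟩).2) ⟨x, hx⟩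
  calc _ ≤ _ := measureReal_mono hsub (measure_ne_top _ _)
    _ ≤ _ := measureReal_biUnion_finset_le _ _
    _ ≤ ∑ p ∈ s ×ˢ s, 4 * Real.exp (-(n * (δ ^ 2 / 256))) := by
      refine Finset.sum_le_sum fun p _ => (measureReal_union_le _ _).trans ?_
      linarith [hbad (p.1 + p.2 : X), hbad (p.1 - p.2 : X)]
    _ = (s.card : ℝ) * s.card * (4 * Real.exp (-(n * (δ ^ 2 / 256)))) := by
      rw [Finset.sum_const, Finset.card_product, nsmul_eq_mul, Nat.cast_mul]
    _ ≤ _ := by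
      have hc : (s.card : ℝ) ≤ 5 ^ Module.finrank ℝ X := by exact_mod_cast hcard
      rw [show (25 : ℝ) = 5 * 5 by norm_num, mul_pow]
      gcongr

/-- A Gaussian matrix is simultaneously a near-isometry on all pairwise sums of finitely many
low-dimensional subspaces with high probability. -/
theorem IsGaussianMatrix.measureReal_exists_not_isNearIsometryOn_le [IsProbabilityMeasure P]
    {n N d L : ℕ} {Φ : Ω → Matrix (Fin n) (Fin N) ℝ} (hΦ : IsGaussianMatrix P Φ) {δ : ℝ}
    (hδ0 : 0 ≤ δ) (hδ : δ ≤ 2) (hn : 0 < n)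
    {X : Fin L → Submodule ℝ (EuclideanSpace ℝ (Fin N))} (hX : ∀ i, Module.finrank ℝ (X i) < d) :
    P.real {ω | ∃ i j, ¬ IsNearIsometryOn (Matrix.toEuclideanLin (Φ ω)) δ (X i ⊔ X j)} ≤
      Real.exp ((2 + Real.log 2500) * max (d : ℝ) (Real.log L) - n * (δ ^ 2 / 256)) := by
  -- For `L = 0` the event is empty. Otherwise `L = exp (log L)`, and `d > 0`, so that `4 * 25 ^ (2
  -- * d) ≤ 2500 ^ d`.
  rcases Nat.eq_zero_or_pos L with rfl | hL
  · simp [Real.exp_nonneg]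
  have hd : 0 < d := (Nat.zero_le _).trans_lt (hX ⟨0, hL⟩)
  have hset : {ω | ∃ i j, ¬ IsNearIsometryOn (Matrix.toEuclideanLin (Φ ω)) δ (X i ⊔ X j)} =
      ⋃ p : Fin L × Fin L,
        {ω | ¬ IsNearIsometryOn (Matrix.toEuclideanLin (Φ ω)) δ (X p.1 ⊔ X p.2)} := by
    ext ω
    simp
  have hone : ∀ p : Fin L × Fin L,
      P.real {ω | ¬ IsNearIsometryOn (Matrix.toEuclideanLin (Φ ω)) δ (X p.1 ⊔ X p.2)} ≤
        2500 ^ d * Real.exp (-(n * (δ ^ 2 / 256))) := by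
    intro p
    refine (hΦ.measureReal_not_isNearIsometryOn_le hδ0 hδ hn _).trans ?_
    have hfin : Module.finrank ℝ ↥(X p.1 ⊔ X p.2) ≤ 2 * d := by
      have := Submodule.finrank_add_le_finrank_add_finrank (X p.1) (X p.2)
      have := hX p.1
      have := hX p.2
      omega
    have h4 : (4 : ℝ) ≤ 4 ^ d := le_self_pow₀ (by norm_num) hd.ne'
    calc _ ≤ (25 : ℝ) ^ (2 * d) * (4 ^ d * Real.exp (-(n * (δ ^ 2 / 256)))) := by
          gcongr
          norm_num
      _ = _ := by
          rw [pow_mul, ← mul_assoc, ← mul_pow]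
          norm_num
  have hL0 : (0 : ℝ) < L := by exact_mod_cast hL
  have hLexp : (L : ℝ) * L = Real.exp (2 * Real.log L) := by
    rw [two_mul, Real.exp_add, Real.exp_log hL0]
  have hdexp : (2500 : ℝ) ^ d = Real.exp (Real.log 2500 * d) := by
    rw [mul_comm, Real.exp_nat_mul, Real.exp_log (by norm_num)]
  have hlog : 0 ≤ Real.log 2500 := Real.log_nonneg (by norm_num)
  rw [hset]
  calc _ ≤ _ := measureReal_iUnion_fintype_le _
    _ ≤ ∑ p : Fin L × Fin L, 2500 ^ d * Real.exp (-(n * (δ ^ 2 / 256))) :=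
      Finset.sum_le_sum fun p _ => hone p
    _ = Real.exp (2 * Real.log L + Real.log 2500 * d + -(n * (δ ^ 2 / 256))) := by
      rw [Finset.sum_const, Finset.card_univ, Fintype.card_prod, Fintype.card_fin, nsmul_eq_mul,
        Nat.cast_mul, hLexp, hdexp, Real.exp_add, Real.exp_add, mul_assoc]
    _ ≤ _ := by
      apply Real.exp_le_exp.2
      have h1 := le_max_right (d : ℝ) (Real.log L)
      have h2 := mul_le_mul_of_nonneg_left (le_max_left (d : ℝ) (Real.log L)) hlog
      linarith

theorem projFDist_lt_of_isNearIsometryOn {n N : ℕ} {M : Matrix (Fin n) (Fin N) ℝ} {ε : ℝ}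
    (hε : 0 < ε) {X Y : Submodule ℝ (EuclideanSpace ℝ (Fin N))} (hXY : X ≠ Y)
    (h : IsNearIsometryOn (Matrix.toEuclideanLin M) (min ε 1 / 4) (X ⊔ Y)) :
    (1 - ε) * projFDist X Y ^ 2 < projFDist (projectSubspace M X) (projectSubspace M Y) ^ 2 ∧
      projFDist (projectSubspace M X) (projectSubspace M Y) ^ 2 < (1 + ε) * projFDist X Y ^ 2 := by
  have hpos := projFDist_sq_pos hXY
  have hη0 : 0 < min ε 1 := lt_min hε one_pos
  have hη1 := min_le_right ε 1
  have hηε := min_le_left ε 1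
  set η := min ε 1
  obtain ⟨h1, h2⟩ := projFDist_bounds_of_isNearIsometryOn h (by linarith) (by linarith)
  set D := projFDist X Y ^ 2
  set D' := projFDist (projectSubspace M X) (projectSubspace M Y) ^ 2
  -- With `δ = η / 4`, the factor `(1 + δ) / (1 - δ)` and its inverse lie strictly inside `1 ± η`;
  -- this slack and `D > 0` give the strict inequalities.
  have e1 : (1 - η) * (1 + η / 4) < 1 - η / 4 := by nlinarith
  have e2 : 1 + η / 4 < (1 + η) * (1 - η / 4) := by nlinarith
  constructor
  · refine lt_of_le_of_lt (mul_le_mul_of_nonneg_right (by linarith : 1 - ε ≤ 1 - η) hpos.le) ?_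
    refine lt_of_mul_lt_mul_left (a := 1 + η / 4) ?_ (by linarith)
    refine lt_of_lt_of_le ?_ h1
    calc _ = (1 - η) * (1 + η / 4) * D := by ring
      _ < _ := mul_lt_mul_of_pos_right e1 hpos
  · refine lt_of_lt_of_le ?_ (mul_le_mul_of_nonneg_right (by linarith : 1 + η ≤ 1 + ε) hpos.le)
    refine lt_of_mul_lt_mul_left (a := 1 - η / 4) ?_ (by linarith)
    refine lt_of_le_of_lt h2 ?_
    calc _ < (1 + η) * (1 - η / 4) * D := mul_lt_mul_of_pos_right e2 hpos
      _ = _ := by ring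

end SubspaceRIP

theorem mainTheorem1 (ε : ℝ) (hε : 0 < ε) :
    ∃ c₁ c₂ : ℝ, 0 < c₁ ∧ 0 < c₂ ∧
      ∀ (N n d L : ℕ), n < N → c₁ * max (d : ℝ) (Real.log (L : ℝ)) < (n : ℝ) →
      ∀ X : Fin L → Submodule ℝ (EuclideanSpace ℝ (Fin N)),
      (∀ i, Module.finrank ℝ (X i) < d) →
      ∀ {Ω : Type*} [MeasurableSpace Ω] (P : Measure Ω) [IsProbabilityMeasure P]
        (Φ : Ω → Matrix (Fin n) (Fin N) ℝ), SubspaceRIP.IsGaussianMatrix P Φ →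
        1 - Real.exp (-(c₂ * (n : ℝ))) ≤
          P.real {ω | ∀ i j, X i ≠ X j →
            (1 - ε) * SubspaceRIP.projFDist (X i) (X j) ^ 2 <
                SubspaceRIP.projFDist (SubspaceRIP.projectSubspace (Φ ω) (X i))
                  (SubspaceRIP.projectSubspace (Φ ω) (X j)) ^ 2 ∧
              SubspaceRIP.projFDist (SubspaceRIP.projectSubspace (Φ ω) (X i))
                  (SubspaceRIP.projectSubspace (Φ ω) (X j)) ^ 2 <
                (1 + ε) * SubspaceRIP.projFDist (X i) (X j) ^ 2} := by
  have hη0 : 0 < min ε 1 := lt_min hε one_pos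
  have hη1 := min_le_right ε 1
  set δ := min ε 1 / 4 with hδ
  have hδ0 : 0 < δ := by positivity
  have hlog : 0 ≤ Real.log 2500 := Real.log_nonneg (by norm_num)
  -- Half of the exponent `n * δ ^ 2 / 256` pays for the union bound through `c₁`; the other half is
  -- `c₂ * n`.
  refine ⟨(2 + Real.log 2500) / (δ ^ 2 / 512), δ ^ 2 / 512, by positivity, by positivity, ?_⟩
  intro N n d L _ hn X hX Ω _ P _ Φ hΦ
  have hmax : 0 ≤ max (d : ℝ) (Real.log L) := le_max_of_le_left (Nat.cast_nonneg d)
  have hn0 : 0 < n := by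
    have : (0 : ℝ) < n := lt_of_le_of_lt (by positivity) hn
    exact_mod_cast this
  have hbad := (hΦ.measureReal_exists_not_isNearIsometryOn_le hδ0.le (by linarith) hn0 hX).trans
    (b := _) (c := Real.exp (-(δ ^ 2 / 512 * n))) (by
      apply Real.exp_le_exp.2
      rw [div_mul_eq_mul_div, div_lt_iff₀ (by positivity)] at hn
      linarith)
  -- Covering the whole space and using subadditivity, rather than taking complements, avoids any
  -- measurability of the events.
  have hcover : (Set.univ : Set Ω) ⊆ {ω | ∀ i j, X i ≠ X j →
            (1 - ε) * SubspaceRIP.projFDist (X i) (X j) ^ 2 <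
                SubspaceRIP.projFDist (SubspaceRIP.projectSubspace (Φ ω) (X i))
                  (SubspaceRIP.projectSubspace (Φ ω) (X j)) ^ 2 ∧
              SubspaceRIP.projFDist (SubspaceRIP.projectSubspace (Φ ω) (X i))
                  (SubspaceRIP.projectSubspace (Φ ω) (X j)) ^ 2 <
                (1 + ε) * SubspaceRIP.projFDist (X i) (X j) ^ 2} ∪
      {ω | ∃ i j, ¬ SubspaceRIP.IsNearIsometryOn (Matrix.toEuclideanLin (Φ ω)) δ
        (X i ⊔ X j)} := by
    intro ω _
    by_cases h : ∃ i j, ¬ SubspaceRIP.IsNearIsometryOn (Matrix.toEuclideanLin (Φ ω)) δ (X i ⊔ X j)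
    · exact Or.inr h
    · push Not at h
      exact Or.inl fun i j hij => SubspaceRIP.projFDist_lt_of_isNearIsometryOn hε hij (h i j)
  have htotal := (measureReal_mono (μ := P) hcover).trans (measureReal_union_le _ _)
  rw [probReal_univ] at htotal
  linarith
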